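/- Let $\mathbb F_q$ be a finite field with $q$ elements and characteristic $p$, $A=\mathbb F_q[\theta]$, $K=\mathbb F_q((1/\theta))$ with the absolute value normalized by $|\theta|=q$, and let $\mathbb C_\infty$ be the completion of an algebraic closure of $K$, with the extended absolute value and the additive valuation $v_\infty(z)=-\log_q|z|$ (so $v_\infty(1/\theta)=1$, $v_\infty(0)=\infty$). Let $A_+$ be the set of monic elements of $A$ and $A_+(j)$ the set of those of degree $j$. For $a\in A_+$ let $\langle a\rangle=\theta^{-\deg a}a$, which is a $1$-unit of $K$, and for $y\in\mathbb Z_p$ let $\langle a\rangle^y=\sum_{n\ge0}\binom yn(\langle a\rangle-1)^n$, where the binomial coefficients $\binom yn\in\mathbb Z_p$ are reduced modulo $p$. Put $\mathbb S_\infty=\mathbb C_\infty^*\times\mathbb Z_p$, and for $s=(x,y)\in\mathbb S_\infty$ put $a^{s}=x^{\deg a}\langle a\rangle^{y}$ and $a^{-s}=x^{-\deg a}\langle a\rangle^{-y}$. A function $f:\mathbb S_\infty\to\mathbb C_\infty$ is called *entire* if for each $y\in\mathbb Z_p$ it is given by $f(x,y)=\sum_{j\ge0}c_j(y)x^{-j}$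 with $|c_j(y)|R^j\to0$ for every real $R$ (an entire power series in $x^{-1}$), and if this family of entire power series depends continuously on $y$ for uniform convergence on bounded sets of values of $x^{-1}$: for all real $R$ and $\varepsilon>0$ there is $\delta>0$ such that $|f(x,y)-f(x,y')|<\varepsilon$ whenever $|y-y'|_p<\delta$ and $|x^{-1}|\le R$. **Theorem 4.2.** Let $t\in\mathbb C_\infty$, let $\beta\ge0$ be an integer, and let $\chi_t(a)=a(t)$ for $a\in A$ (with $\chi_t(a)^0=1$). The Pellarin $L$-series $L(\chi_t^\beta,s)=\sum_{a\in A_+}\chi_t(a)^\beta a^{-s}$ converges for all $s=(x,y)\in\mathbb S_\infty$ with $|x|>\max\{1,|t|\}^\beta$ and continues analytically to an entire function on $\mathbb S_\infty$. More precisely, there is an entire function $L:\mathbb S_\infty\to\mathbb C_\infty$, continuous on $\mathbb S_\infty$ (jointly in $(x,y)$), that is equal to the sum of the $L$-series for $|x|>\max\{1,|t|\}^\beta$ and satisfies $$L(x,y)=\sum_{j=0}^\infty x^{-j}\Bigl(\sum_{a\in A_+(j)}\chi_t(a)^\beta\langle a\rangle^{-y}\Bigr)\qquad\text{for all }(x,y)\in\mathbb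 S_\infty .$$ Moreover, for every $0\ne\alpha\in\mathbb C_\infty$ with $-v_\infty(\alpha)\ge\max\{-v_\infty(t)+1,1\}$, the coefficient $c_j(y)=\sum_{a\in A_+(j)}(\chi_t(a)/\alpha^j)^\beta\langle a\rangle^{-y}$ of $x^{-j}$ in $L(\alpha^\beta x,y)$ satisfies $v_\infty(c_j(y))\ge (q-1)\,j(j+1)/2$ for all $j\ge0$ and $y\in\mathbb Z_p$. -/

import Mathlib

open Filter Topology
open scoped NNReal WithZero

noncomputable section

namespace Pellarin

/-! Throughout, `Fq` is a finite field with `q = Fintype.card Fq` elements and of characteristic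
`p`, and `A = Fq[θ]` is `Polynomial Fq`. -/

section Fields

variable (Fq : Type*) [Field Fq] [Fintype Fq]

/-- `K = Fq((1/θ))`: Laurent series over `Fq` whose variable `X` is `1/θ`. -/
abbrev KInf : Type _ := LaurentSeries Fq

lemma one_lt_card : (1 : ℝ≥0) < (Fintype.card Fq : ℝ≥0) := by
  exact_mod_cast Fintype.one_lt_card

/-- The `X`-adic valuation of `K` has rank one; the embedding of its value group into the reals
is the one that sends the generator `exp 1` to `q`, so that the absolute value below has
`|θ| = |X⁻¹| = q`. -/
instance rankOneKInf : Valuation.RankOne (Valued.v : Valuation (KInf Fq) ℤᵐ⁰) where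
  hom' := (WithZeroMulInt.toNNReal (one_lt_card Fq).ne_zero).comp
    MonoidWithZeroHom.ValueGroup₀.embedding
  strictMono' := (WithZeroMulInt.toNNReal_strictMono (one_lt_card Fq)).comp
    MonoidWithZeroHom.ValueGroup₀.embedding_strictMono
  exists_val_nontrivial := by
    refine ⟨HahnSeries.single 1 1, ?_, ?_⟩
    · rw [LaurentSeries.valuation_single_zpow]
      exact WithZero.exp_ne_zero
    · rw [LaurentSeries.valuation_single_zpow, ← WithZero.exp_zero]
      intro h
      simpa using WithZero.exp_injective h

/-- The absolute value of `K`, normalized by `|θ| = q`. -/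
instance nontriviallyNormedFieldKInf : NontriviallyNormedField (KInf Fq) :=
  Valued.toNontriviallyNormedField (KInf Fq) ℤᵐ⁰

instance ultrametricKInf : IsUltrametricDist (KInf Fq) :=
  Valued.instIsUltrametricDist (KInf Fq) ℤᵐ⁰

/-- A fixed algebraic closure of `K`. -/
abbrev KBar : Type _ := AlgebraicClosure (KInf Fq)

/-- The algebraic closure of `K` with the unique extension of the absolute value of `K`. -/
instance normedFieldKBar : NormedField (KBar Fq) := spectralNorm.normedField (KInf Fq) (KBar Fq)

/-- `ℂ_∞`: the completion of the algebraic closure of `K`, with the extended absolute value. -/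
abbrev CInf : Type _ := UniformSpace.Completion (KBar Fq)

/-- The embedding of `K` into `ℂ_∞`. -/
def ofKInf : KInf Fq →+* CInf Fq :=
  (UniformSpace.Completion.coeRingHom (α := KBar Fq)).comp (algebraMap (KInf Fq) (KBar Fq))

/-- The embedding of the constants `Fq` into `ℂ_∞`. -/
def ofConst : Fq →+* CInf Fq := (ofKInf Fq).comp HahnSeries.C

/-- The element `θ = X⁻¹` of `K ⊆ ℂ_∞`. -/
def theta : CInf Fq := ofKInf Fq (HahnSeries.single (-1) 1)

variable {Fq}

/-- The additive valuation `v_∞` of `ℂ_∞`, extending the one of `K` with `v_∞(1/θ) = 1`: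
`v_∞(z) = -log_q |z|` for `z ≠ 0`, and `v_∞(0) = ∞`. -/
def vInf (z : CInf Fq) : EReal :=
  open Classical in
  if z = 0 then ⊤ else ((-Real.logb (Fintype.card Fq) ‖z‖ : ℝ) : EReal)

end Fields

section LSeries

variable {Fq : Type*} [Field Fq] [Fintype Fq]

/-- The quasi-character `χ_t`: the `Fq`-algebra map `A → ℂ_∞`, `f ↦ f(t)`. -/
def chi (t : CInf Fq) : Polynomial Fq →+* CInf Fq := Polynomial.eval₂RingHom (ofConst Fq) t

/-- The 1-unit `⟨a⟩ = π^{deg a} a`, where `π = 1/θ`, of a monic polynomial `a = a(θ)`. -/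
def oneUnit (a : Polynomial Fq) : CInf Fq :=
  (1 / theta Fq) ^ a.natDegree * Polynomial.eval₂ (ofConst Fq) (theta Fq) a

variable {p : ℕ} [Fact p.Prime] [CharP Fq p]

/-- The power `u^y` of a 1-unit `u` with exponent `y ∈ ℤ_p`, by the Binomial Theorem:
`u^y = ∑ₙ (y choose n) (u - 1)^n`, the binomial coefficients in `ℤ_p` being reduced modulo `p`. -/
def unitPow (u : CInf Fq) (y : ℤ_[p]) : CInf Fq :=
  ∑' n : ℕ, ofConst Fq (ZMod.castHom (dvd_refl p) Fq (PadicInt.toZMod (Ring.choose y n))) *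
    (u - 1) ^ n

/-- `S_∞ = ℂ_∞^* × ℤ_p`. -/
abbrev SInf (Fq : Type*) [Field Fq] [Fintype Fq] (p : ℕ) [Fact p.Prime] : Type _ :=
  (CInf Fq)ˣ × ℤ_[p]

/-- `-s` in the commutative group `S_∞`: the first factor is multiplicative, the second additive. -/
def negS (s : SInf Fq p) : SInf Fq p := (s.1⁻¹, -s.2)

/-- `a^s = x^{deg a} ⟨a⟩^y` for `s = (x, y) ∈ S_∞` and `a` monic. -/
def expS (a : Polynomial Fq) (s : SInf Fq p) : CInf Fq :=
  (s.1 : CInf Fq) ^ a.natDegree * unitPow (oneUnit a) s.2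

/-- The term `χ_t(a)^β a^{-s}` of the Pellarin `L`-series. -/
def pellarinTerm (t : CInf Fq) (β : ℕ) (s : SInf Fq p) (a : Polynomial Fq) : CInf Fq :=
  chi t a ^ β * expS a (negS s)

variable (Fq) in
lemma finite_monicsOfDegree (j : ℕ) :
    {a : Polynomial Fq | a.Monic ∧ a.natDegree = j}.Finite := by
  classical
  refine Set.Finite.of_injOn (f := fun a (i : Fin (j + 1)) => a.coeff i)
    (t := Set.univ) (fun _ _ => Set.mem_univ _) ?_ Set.finite_univ
  intro a ha b hb hab
  ext n
  by_cases hn : n < j + 1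
  · exact congrFun hab ⟨n, hn⟩
  · rw [Polynomial.coeff_eq_zero_of_natDegree_lt (by have := ha.2; omega),
      Polynomial.coeff_eq_zero_of_natDegree_lt (by have := hb.2; omega)]

variable (Fq) in
/-- `A_+(j)`: the monic polynomials of degree `j`. -/
def monicsOfDegree (j : ℕ) : Finset (Polynomial Fq) := (finite_monicsOfDegree Fq j).toFinset

/-- The coefficient `∑_{a ∈ A_+(j)} χ_t(a)^β ⟨a⟩^{-y}` of `x^{-j}` in the expansion of
`L(χ_t^β, (x, y))` by degrees. -/
def pellarinCoeff (t : CInf Fq) (β j : ℕ) (y : ℤ_[p]) : CInf Fq :=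
  ∑ a ∈ monicsOfDegree Fq j, chi t a ^ β * unitPow (oneUnit a) (-y)

/-- Entire functions on `S_∞` in the sense of Goss: continuous one-parameter families, indexed by
`y ∈ ℤ_p`, of entire power series `f(x, y) = ∑_j c_j(y) x^{-j}` in `x^{-1}`.  Continuity is for the
topology of uniform convergence on bounded sets of values of `x^{-1}` (it is automatically
uniform in `y`, as `ℤ_p` is compact). -/
def IsEntire (f : SInf Fq p → CInf Fq) : Prop :=
  (∃ c : ℕ → ℤ_[p] → CInf Fq,
    (∀ y (R : ℝ), Tendsto (fun j => ‖c j y‖ * R ^ j) atTop (𝓝 0)) ∧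
    ∀ s : SInf Fq p, HasSum (fun j => c j s.2 * ((s.1⁻¹ : (CInf Fq)ˣ) : CInf Fq) ^ j) (f s)) ∧
  ∀ R ε : ℝ, 0 < ε → ∃ δ : ℝ, 0 < δ ∧ ∀ y y' : ℤ_[p], ‖y - y'‖ < δ →
    ∀ x : (CInf Fq)ˣ, ‖((x⁻¹ : (CInf Fq)ˣ) : CInf Fq)‖ ≤ R → ‖f (x, y) - f (x, y')‖ < ε

end LSeries

end Pellarin

end

/-! Write a monic `a` of degree `j` through its lower coefficients `f ∈ Fq^j`. Then `⟨a⟩ - 1` and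
`χ_t(a)/α^j` are affine forms in `f` whose coefficient at `f_i` has size at most `|θ|^{-(j-i)}`.
Expanding `⟨a⟩^{-y}` by the binomial series turns `c_j(y)` into a convergent sum of values `∑_f
P(f)`, where `P` is a polynomial whose coefficient at `f^m` is at most `|θ|^{-∑ (j-i) m_i}`. Since
`∑_{c ∈ Fq} c^k = 0` for `k < q - 1`, only monomials with every `m_i ≥ q - 1` survive, so
`v_∞(c_j(y)) ≥ (q-1)(1 + ⋯ + j)` (`MvPolynomial.norm_sum_eval_le`, `norm_pellarinCoeff_div_le`).

This quadratic growth, uniform in `y`, beats every `R^j` (`exists_summable_bound`) and yields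
entireness and continuity. On the half-plane the terms tend to zero, so the ultrametric series
converges unconditionally and may be regrouped by degree. -/

noncomputable section

/-! ### Sums of polynomials over the points of a finite field -/

/-- The multivariate polynomials whose coefficient at `m` has norm at most `r ^ ∑ i, w i * m i`. -/
def MvPolynomial.weightedNormSubring {σ E : Type*} [Fintype σ] [NormedField E]
    [IsUltrametricDist E] (r : ℝ) (hr : 0 ≤ r) (w : σ → ℕ) : Subring (MvPolynomial σ E) where
  carrier := {P | ∀ m, ‖P.coeff m‖ ≤ r ^ ∑ i, w i * m i}
  zero_mem' m := by simpa using pow_nonneg hr _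
  one_mem' m := by
    classical
    rw [MvPolynomial.coeff_one]
    split_ifs with h
    · simp [← h]
    · simpa using pow_nonneg hr _
  add_mem' {P Q} hP hQ m := by
    rw [MvPolynomial.coeff_add]
    exact (IsUltrametricDist.norm_add_le_max _ _).trans (max_le (hP m) (hQ m))
  neg_mem' {P} hP m := by
    rw [MvPolynomial.coeff_neg, norm_neg]
    exact hP m
  mul_mem' {P Q} hP hQ m := by
    classical
    rw [MvPolynomial.coeff_mul]
    refine IsUltrametricDist.norm_sum_le_of_forall_le_of_nonneg (pow_nonneg hr _) fun x hx => ?_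
    rw [norm_mul, ← Finset.HasAntidiagonal.mem_antidiagonal.mp hx]
    simp only [Finsupp.add_apply, mul_add, Finset.sum_add_distrib, pow_add]
    exact mul_le_mul (hP _) (hQ _) (norm_nonneg _) (pow_nonneg hr _)

namespace MvPolynomial

variable {σ E : Type*} [Fintype σ] [NormedField E] [IsUltrametricDist E] {r : ℝ} {hr : 0 ≤ r}
  {w : σ → ℕ}

lemma C_mem_weightedNormSubring {c : E} (hc : ‖c‖ ≤ 1) : C c ∈ weightedNormSubring r hr w := by
  classical
  intro m
  rw [coeff_C]
  split_ifs with h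
  · simpa [← h] using hc
  · simpa using pow_nonneg hr _

lemma C_mul_X_mem_weightedNormSubring {c : E} {i : σ} (hc : ‖c‖ ≤ r ^ w i) :
    C c * X i ∈ weightedNormSubring r hr w := by
  classical
  intro m
  rw [coeff_C_mul, coeff_X]
  split_ifs with h
  · rw [← h, mul_one]
    refine hc.trans_eq ?_
    congr 1
    simp [Finsupp.single_apply]
  · simpa using pow_nonneg hr _

/-- Over the points of a finite field only the monomials with all exponents at least `q - 1`
contribute to the sum of the values of a polynomial. -/
lemma norm_sum_eval_le {F : Type*} [Field F] [Fintype F] [DecidableEq σ] (φ : F →+* E) (hr1 : r ≤ 1)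
    {P : MvPolynomial σ E} (hP : P ∈ weightedNormSubring r hr w) (hφ : ∀ c, ‖φ c‖ ≤ 1) :
    ‖∑ x : σ → F, eval (fun i => φ (x i)) P‖ ≤ r ^ ((Fintype.card F - 1) * ∑ i, w i) := by
  simp only [eval_eq']
  rw [Finset.sum_comm]
  refine IsUltrametricDist.norm_sum_le_of_forall_le_of_nonneg (pow_nonneg hr _) fun m _ => ?_
  rw [← Finset.mul_sum]
  have hprod : ∑ x : σ → F, ∏ i, φ (x i) ^ m i = ∏ i, φ (∑ c : F, c ^ m i) := by
    simp only [map_sum, map_pow]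
    rw [Finset.prod_univ_sum, Fintype.piFinset_univ]
  rw [hprod]
  by_cases h : ∃ i, m i < Fintype.card F - 1
  · obtain ⟨i, hi⟩ := h
    -- The power sum vanishes also for exponent `0`, where it equals `q = 0` in `F`.
    rw [Finset.prod_eq_zero (Finset.mem_univ i)
      (by rw [FiniteField.sum_pow_lt_card_sub_one F _ hi, map_zero])]
    simpa using pow_nonneg hr _
  · push Not at h
    rw [norm_mul, norm_prod]
    refine (mul_le_of_le_one_right (norm_nonneg _)
      (Finset.prod_le_one (fun _ _ => norm_nonneg _) fun i _ => hφ _)).trans ((hP m).trans ?_)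
    refine pow_le_pow_of_le_one hr hr1 ?_
    rw [Finset.mul_sum]
    refine Finset.sum_le_sum fun i _ => ?_
    rw [mul_comm]
    exact Nat.mul_le_mul_left _ (h i)

end MvPolynomial

/-- The triangular exponent makes `B ^ j * r ^ (0 + 1 + ⋯ + j)` summable for every `B`. -/
lemma summable_pow_mul_pow_triangular {r : ℝ} (hr0 : 0 < r) (hr1 : r < 1) (B : ℝ) (hB : 0 ≤ B) :
    Summable fun j : ℕ => B ^ j * r ^ ∑ i ∈ Finset.range (j + 1), i := by
  -- The ratio test needs nonzero terms, so `B = 0` is separate; otherwise the ratio is `B * r ^ (j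
  -- + 1)`.
  rcases hB.eq_or_lt with rfl | hB
  · refine summable_of_ne_finset_zero (s := {0}) fun j hj => ?_
    rw [zero_pow (by simpa using hj), zero_mul]
  refine summable_of_ratio_test_tendsto_lt_one (l := 0) zero_lt_one
    (Eventually.of_forall fun j => by positivity) ?_
  have h : Tendsto (fun j : ℕ => B * r ^ (j + 1)) atTop (𝓝 0) := by
    simpa using ((tendsto_pow_atTop_nhds_zero_of_lt_one hr0.le hr1).comp
      (tendsto_add_atTop_nat 1)).const_mul B
  refine h.congr fun j => ?_
  rw [Real.norm_of_nonneg (by positivity), Real.norm_of_nonneg (by positivity),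
    Finset.sum_range_succ _ (j + 1), pow_add r, eq_div_iff (by positivity)]
  ring

lemma PadicInt.toZMod_eq_of_norm_sub_lt_one {p : ℕ} [Fact p.Prime] {x y : ℤ_[p]}
    (h : ‖x - y‖ < 1) : PadicInt.toZMod x = PadicInt.toZMod y := by
  rw [← sub_eq_zero, ← map_sub, ← RingHom.mem_ker, PadicInt.ker_toZMod,
    IsLocalRing.mem_maximalIdeal, PadicInt.mem_nonunits]
  exact h

namespace Pellarin

/-! ### The ultrametric absolute value of `ℂ_∞` -/

section Norm

variable (Fq : Type*) [Field Fq] [Fintype Fq]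

instance ultrametricKBar : IsUltrametricDist (KBar Fq) :=
  IsUltrametricDist.isUltrametricDist_of_isNonarchimedean_norm
    (isNonarchimedean_spectralNorm (K := KInf Fq) (L := KBar Fq))

instance ultrametricCInf : IsUltrametricDist (CInf Fq) :=
  IsUltrametricDist.isUltrametricDist_of_isNonarchimedean_norm fun x y => by
    induction x, y using UniformSpace.Completion.induction_on₂ with
    | hp => exact isClosed_le (by fun_prop) (by fun_prop)
    | ih x y =>
      rw [← UniformSpace.Completion.coe_add]
      simp only [UniformSpace.Completion.norm_coe]
      exact IsUltrametricDist.norm_add_le_max x y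

variable {Fq}

lemma norm_ofKInf (x : KInf Fq) : ‖ofKInf Fq x‖ = ‖x‖ :=
  (UniformSpace.Completion.norm_coe _).trans (spectralNorm_extends x)

/-- Nonzero constants are roots of unity. -/
lemma norm_ofConst_le_one (c : Fq) : ‖ofConst Fq c‖ ≤ 1 := by
  rcases eq_or_ne c 0 with rfl | hc
  · simp
  · have h : ofConst Fq c ^ (Fintype.card Fq - 1) = 1 := by
      rw [← map_pow, FiniteField.pow_card_sub_one_eq_one c hc, map_one]
    rw [← pow_le_one_iff_of_nonneg (norm_nonneg _) 
      (Nat.sub_ne_zero_of_lt (Fintype.one_lt_card (α := Fq))),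
      ← norm_pow, h, norm_one]

variable (Fq) in
lemma norm_theta : ‖theta Fq‖ = Fintype.card Fq := by
  rw [theta, norm_ofKInf, Valued.toNormedField.norm_def]
  change ((WithZeroMulInt.toNNReal (one_lt_card Fq).ne_zero
    (MonoidWithZeroHom.ValueGroup₀.embedding _) : ℝ≥0) : ℝ) = _
  rw [Valuation.embedding_restrict, LaurentSeries.valuation_single_zpow]
  rw [WithZeroMulInt.toNNReal_neg_apply _ WithZero.exp_ne_zero]
  simp [WithZero.exp]


lemma theta_ne_zero : theta Fq ≠ 0 := by
  rw [← norm_ne_zero_iff, norm_theta]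
  exact_mod_cast Fintype.card_ne_zero

end Norm
-- Powers of 1-units with `p`-adic exponents
section UnitPow

variable {Fq : Type*} [Field Fq] [Fintype Fq] {p : ℕ} [Fact p.Prime] [CharP Fq p]

variable (Fq) in
/-- The binomial coefficient `y choose n`, reduced modulo `p`, in `ℂ_∞`. -/
def chooseMod (y : ℤ_[p]) (n : ℕ) : CInf Fq :=
  ofConst Fq (ZMod.castHom (dvd_refl p) Fq (PadicInt.toZMod (Ring.choose y n)))

lemma norm_chooseMod_le_one (y : ℤ_[p]) (n : ℕ) : ‖chooseMod Fq y n‖ ≤ 1 :=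
  norm_ofConst_le_one _

/-- Reduction modulo `p` is locally constant and `y ↦ (y choose n)` is continuous on `ℤ_p`, so the
composite is locally constant. -/
lemma continuous_chooseMod (n : ℕ) : Continuous fun y : ℤ_[p] => chooseMod Fq y n := by
  have h : IsLocallyConstant fun y : ℤ_[p] => PadicInt.toZMod y := by
    rw [IsLocallyConstant.iff_eventually_eq]
    intro y
    filter_upwards [Metric.ball_mem_nhds y one_pos] with z hz
    exact PadicInt.toZMod_eq_of_norm_sub_lt_one (by simpa [dist_eq_norm] using hz)
  exact ((h.comp_continuous (PadicInt.continuous_choose n)).comp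
    fun c => ofConst Fq (ZMod.castHom (dvd_refl p) Fq c)).continuous

lemma norm_chooseMod_mul_pow_le (u : CInf Fq) (y : ℤ_[p]) (n : ℕ) :
    ‖chooseMod Fq y n * (u - 1) ^ n‖ ≤ ‖u - 1‖ ^ n := by
  rw [norm_mul, norm_pow]
  exact mul_le_of_le_one_left (by positivity) (norm_chooseMod_le_one y n)

lemma hasSum_unitPow {u : CInf Fq} (hu : ‖u - 1‖ < 1) (y : ℤ_[p]) :
    HasSum (fun n => chooseMod Fq y n * (u - 1) ^ n) (unitPow u y) :=
  (Summable.of_norm_bounded (summable_geometric_of_lt_one (norm_nonneg _) hu)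
    (norm_chooseMod_mul_pow_le u y)).hasSum

lemma continuous_unitPow {u : CInf Fq} (hu : ‖u - 1‖ < 1) :
    Continuous (unitPow (p := p) u) :=
  continuous_tsum (fun n => (continuous_chooseMod n).mul continuous_const)
    (summable_geometric_of_lt_one (norm_nonneg _) hu) fun n y => norm_chooseMod_mul_pow_le u y n

lemma norm_le_of_hasSum {ι E : Type*} [NormedAddCommGroup E] [IsUltrametricDist E] {f : ι → E}
    {a : E} {C : ℝ} (hC : 0 ≤ C) (h : HasSum f a) (hf : ∀ i, ‖f i‖ ≤ C) : ‖a‖ ≤ C :=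
  le_of_tendsto h.norm <| Eventually.of_forall fun _ =>
    IsUltrametricDist.norm_sum_le_of_forall_le_of_nonneg hC fun i _ => hf i

lemma norm_unitPow_le_one {u : CInf Fq} (hu : ‖u - 1‖ < 1) (y : ℤ_[p]) : ‖unitPow u y‖ ≤ 1 :=
  norm_le_of_hasSum zero_le_one (hasSum_unitPow hu y) fun n =>
    (norm_chooseMod_mul_pow_le u y n).trans (pow_le_one₀ (norm_nonneg _) hu.le)

end UnitPow

/-! ### Monic polynomials as points of `Fq^j`, and the valuation estimate -/

section Coeffs

variable {Fq : Type*} [Field Fq]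

/-- The monic polynomial of degree `j` with lower coefficients `f`. -/
def monicOfCoeffs (j : ℕ) (f : Fin j → Fq) : Polynomial Fq :=
  Polynomial.X ^ j + ∑ i : Fin j, Polynomial.C (f i) * Polynomial.X ^ (i : ℕ)

lemma coeff_monicOfCoeffs {j : ℕ} (f : Fin j → Fq) (i : Fin j) :
    (monicOfCoeffs j f).coeff i = f i := by
  simp [monicOfCoeffs, Polynomial.coeff_X_pow, i.2.ne, Fin.val_inj]

variable [Fintype Fq]

lemma mem_monicsOfDegree {j : ℕ} {a : Polynomial Fq} :
    a ∈ monicsOfDegree Fq j ↔ a.Monic ∧ a.natDegree = j := by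
  simp [monicsOfDegree]

lemma monicOfCoeffs_mem (j : ℕ) (f : Fin j → Fq) :
    monicOfCoeffs j f ∈ monicsOfDegree Fq j := by
  have h := Polynomial.degree_sum_fin_lt f
  refine mem_monicsOfDegree.mpr ⟨Polynomial.monic_X_pow_add h, ?_⟩
  rw [monicOfCoeffs, Polynomial.natDegree_add_eq_left_of_degree_lt (by simpa using h),
    Polynomial.natDegree_X_pow]

lemma monicOfCoeffs_coeff {j : ℕ} {a : Polynomial Fq} (ha : a ∈ monicsOfDegree Fq j) :
    monicOfCoeffs j (fun i => a.coeff i) = a := by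
  obtain ⟨hm, rfl⟩ := mem_monicsOfDegree.mp ha
  conv_rhs => rw [hm.as_sum]
  rw [monicOfCoeffs, Finset.sum_range]

lemma sum_monicsOfDegree {M : Type*} [AddCommMonoid M] (j : ℕ) (g : Polynomial Fq → M) :
    ∑ a ∈ monicsOfDegree Fq j, g a = ∑ f : Fin j → Fq, g (monicOfCoeffs j f) :=
  (Finset.sum_bij' (fun f _ => monicOfCoeffs j f) (fun a _ i => a.coeff i)
    (fun f _ => monicOfCoeffs_mem j f) (fun _ _ => Finset.mem_univ _)
    (fun f _ => funext fun i => coeff_monicOfCoeffs f i) (fun _ ha => monicOfCoeffs_coeff ha)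
    fun _ _ => rfl).symm

lemma eval₂_monicOfCoeffs {j : ℕ} (f : Fin j → Fq) (x : CInf Fq) :
    (monicOfCoeffs j f).eval₂ (ofConst Fq) x =
      x ^ j + ∑ i : Fin j, ofConst Fq (f i) * x ^ (i : ℕ) := by
  simp [monicOfCoeffs, Polynomial.eval₂_finsetSum]

variable (Fq) in
/-- `⟨a⟩ - 1` for `a` monic of degree `j`, as a linear form in the lower coefficients of `a`. -/
def oneUnitForm (j : ℕ) : MvPolynomial (Fin j) (CInf Fq) :=
  ∑ i : Fin j, MvPolynomial.C ((theta Fq)⁻¹ ^ (j - i : ℕ)) * MvPolynomial.X i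

/-- `χ_t(a) / α^j` for `a` monic of degree `j`, as an affine form in the lower coefficients
of `a`. -/
def chiForm (t α : CInf Fq) (j : ℕ) : MvPolynomial (Fin j) (CInf Fq) :=
  MvPolynomial.C ((t / α) ^ j) +
    ∑ i : Fin j, MvPolynomial.C (t ^ (i : ℕ) / α ^ j) * MvPolynomial.X i

lemma eval_oneUnitForm {j : ℕ} (f : Fin j → Fq) :
    MvPolynomial.eval (fun i => ofConst Fq (f i)) (oneUnitForm Fq j) =
      oneUnit (monicOfCoeffs j f) - 1 := by
  have hθ := theta_ne_zero (Fq := Fq)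
  rw [oneUnit, eval₂_monicOfCoeffs, (mem_monicsOfDegree.mp (monicOfCoeffs_mem j f)).2, mul_add,
    ← mul_pow, one_div_mul_cancel hθ, one_pow, add_sub_cancel_left, Finset.mul_sum]
  simp only [oneUnitForm, map_sum, map_mul, MvPolynomial.eval_C, MvPolynomial.eval_X]
  refine Finset.sum_congr rfl fun i _ => ?_
  rw [one_div, pow_sub₀ _ (inv_ne_zero hθ) i.2.le, inv_pow _ (i : ℕ), inv_inv]
  ring

lemma eval_chiForm (t α : CInf Fq) {j : ℕ} (f : Fin j → Fq) :
    MvPolynomial.eval (fun i => ofConst Fq (f i)) (chiForm t α j) =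
      chi t (monicOfCoeffs j f) / α ^ j := by
  rw [chi, Polynomial.coe_eval₂RingHom, eval₂_monicOfCoeffs, add_div, Finset.sum_div, ← div_pow]
  simp only [chiForm, map_add, map_sum, map_mul, MvPolynomial.eval_C, MvPolynomial.eval_X]
  congr 1
  refine Finset.sum_congr rfl fun i _ => ?_
  ring

lemma norm_theta_inv_le_one : ‖(theta Fq)⁻¹‖ ≤ 1 := by
  rw [norm_inv, norm_theta]
  exact inv_le_one_of_one_le₀ (by exact_mod_cast Fintype.card_pos)

lemma norm_theta_inv_lt_one : ‖(theta Fq)⁻¹‖ < 1 := by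
  rw [norm_inv, norm_theta]
  exact inv_lt_one_of_one_lt₀ (by exact_mod_cast Fintype.one_lt_card)

lemma norm_oneUnit_sub_one_lt_one {a : Polynomial Fq} (ha : a.Monic) : ‖oneUnit a - 1‖ < 1 := by
  rw [← monicOfCoeffs_coeff (mem_monicsOfDegree.mpr ⟨ha, rfl⟩), ← eval_oneUnitForm]
  refine lt_of_le_of_lt ?_ (norm_theta_inv_lt_one (Fq := Fq))
  simp only [oneUnitForm, map_sum, map_mul, MvPolynomial.eval_C, MvPolynomial.eval_X]
  refine IsUltrametricDist.norm_sum_le_of_forall_le_of_nonneg (norm_nonneg _) fun i _ => ?_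
  rw [norm_mul, norm_pow]
  refine (mul_le_of_le_one_right (by positivity) (norm_ofConst_le_one _)).trans ?_
  exact pow_le_of_le_one (norm_nonneg _) norm_theta_inv_le_one (Nat.sub_ne_zero_of_lt i.2)

lemma norm_chi_le (t : CInf Fq) (a : Polynomial Fq) :
    ‖chi t a‖ ≤ max 1 ‖t‖ ^ a.natDegree := by
  rw [chi, Polynomial.coe_eval₂RingHom, Polynomial.eval₂_eq_sum_range]
  refine IsUltrametricDist.norm_sum_le_of_forall_le_of_nonneg (by positivity) fun i hi => ?_
  rw [norm_mul, norm_pow]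
  refine (mul_le_of_le_one_left (by positivity) (norm_ofConst_le_one _)).trans ?_
  exact (pow_le_pow_left₀ (norm_nonneg _) (le_max_right _ _) i).trans
    (pow_le_pow_right₀ (le_max_left _ _) (Finset.mem_range_succ_iff.mp hi))

lemma oneUnitForm_mem (j : ℕ) : oneUnitForm Fq j ∈
    MvPolynomial.weightedNormSubring ‖(theta Fq)⁻¹‖ (norm_nonneg _) fun i : Fin j => j - i :=
  sum_mem fun _ _ => MvPolynomial.C_mul_X_mem_weightedNormSubring (norm_pow _ _).le

/-- Of the `j` factors `α⁻¹`, `i` are spent on making `t ^ i` harmless, and the other `j - i` supply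
the weight. This is why `α` must dominate both `θt` and `θ`. -/
lemma chiForm_mem {t α : CInf Fq} (ht : ‖t / α‖ ≤ ‖(theta Fq)⁻¹‖)
    (hα' : ‖α⁻¹‖ ≤ ‖(theta Fq)⁻¹‖) (j : ℕ) : chiForm t α j ∈
    MvPolynomial.weightedNormSubring ‖(theta Fq)⁻¹‖ (norm_nonneg _) fun i : Fin j => j - i := by
  refine add_mem (MvPolynomial.C_mem_weightedNormSubring ?_)
    (sum_mem fun i _ => MvPolynomial.C_mul_X_mem_weightedNormSubring ?_)
  · rw [norm_pow]
    exact pow_le_one₀ (norm_nonneg _) (ht.trans norm_theta_inv_le_one)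
  · have h : t ^ (i : ℕ) / α ^ j = (t / α) ^ (i : ℕ) * α⁻¹ ^ (j - i : ℕ) := by
      rw [← pow_sub_mul_pow α i.2.le, div_pow, inv_pow, div_eq_mul_inv, div_eq_mul_inv, mul_inv]
      ring
    rw [h, norm_mul, norm_pow, norm_pow]
    exact (mul_le_of_le_one_left (by positivity) (pow_le_one₀ (norm_nonneg _)
      (ht.trans norm_theta_inv_le_one))).trans (pow_le_pow_left₀ (norm_nonneg _) hα' _)

variable {p : ℕ} [Fact p.Prime] [CharP Fq p]

/-- Interchanging the binomial series with the finite sum over `a` makes each term the sum of one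
polynomial over `Fq^j`. -/
lemma hasSum_pellarinCoeff_div (t α : CInf Fq) (β j : ℕ) (y : ℤ_[p]) :
    HasSum (fun n => ∑ f : Fin j → Fq, MvPolynomial.eval (fun i => ofConst Fq (f i))
        (chiForm t α j ^ β * (MvPolynomial.C (chooseMod Fq (-y) n) * oneUnitForm Fq j ^ n)))
      (pellarinCoeff t β j y / (α ^ j) ^ β) := by
  rw [pellarinCoeff, sum_monicsOfDegree, Finset.sum_div]
  refine hasSum_sum fun f _ => ?_
  simp only [map_mul, map_pow, MvPolynomial.eval_C, eval_oneUnitForm, eval_chiForm]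
  rw [mul_div_right_comm, ← div_pow]
  exact (hasSum_unitPow (norm_oneUnit_sub_one_lt_one
    (mem_monicsOfDegree.mp (monicOfCoeffs_mem j f)).1) (-y)).mul_left _

/-- The weighted bounds are stable under products and the binomial coefficients have norm at most
`1`, so the estimate is uniform in the index `n` of the binomial series and passes to its sum. -/
lemma norm_pellarinCoeff_div_le {t α : CInf Fq} (ht : ‖t / α‖ ≤ ‖(theta Fq)⁻¹‖)
    (hα' : ‖α⁻¹‖ ≤ ‖(theta Fq)⁻¹‖) (β j : ℕ) (y : ℤ_[p]) :
    ‖pellarinCoeff t β j y / (α ^ j) ^ β‖ ≤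
      ‖(theta Fq)⁻¹‖ ^ ((Fintype.card Fq - 1) * ∑ i ∈ Finset.range (j + 1), i) := by
  have hsum : ∑ i ∈ Finset.range (j + 1), i = ∑ i : Fin j, (j - i : ℕ) := by
    rw [← Finset.sum_range_reflect, Finset.sum_range_succ, Finset.sum_range]
    simp
  rw [hsum]
  refine norm_le_of_hasSum (by positivity) (hasSum_pellarinCoeff_div t α β j y) fun n => ?_
  exact MvPolynomial.norm_sum_eval_le (ofConst Fq) norm_theta_inv_le_one
    (mul_mem (pow_mem (chiForm_mem ht hα' j) β)
      (mul_mem (MvPolynomial.C_mem_weightedNormSubring (norm_chooseMod_le_one _ _))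
        (pow_mem (oneUnitForm_mem j) n))) norm_ofConst_le_one

end Coeffs

/-! ### From the estimate to the entire function -/

section Main

variable {Fq : Type*} [Field Fq] [Fintype Fq]

lemma le_vInf_of_norm_le {z : CInf Fq} {n : ℕ} (h : ‖z‖ ≤ ‖(theta Fq)⁻¹‖ ^ n) :
    ((n : ℝ) : EReal) ≤ vInf z := by
  have hq : (1 : ℝ) < Fintype.card Fq := by exact_mod_cast Fintype.one_lt_card
  rw [vInf]
  split_ifs with hz
  · exact le_top
  · rw [EReal.coe_le_coe_iff, le_neg, Real.logb_le_iff_le_rpow hq (norm_pos_iff.mpr hz),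
      Real.rpow_neg (by positivity), Real.rpow_natCast, ← inv_pow]
    rwa [norm_inv, norm_theta] at h

lemma neg_vInf_of_ne_zero {z : CInf Fq} (hz : z ≠ 0) :
    -vInf z = ((Real.logb (Fintype.card Fq) ‖z‖ : ℝ) : EReal) := by
  rw [vInf, if_neg hz, ← EReal.coe_neg, neg_neg]

lemma norm_inv_le_of_one_le_neg_vInf {α : CInf Fq} (hα : α ≠ 0) (h : 1 ≤ -vInf α) :
    ‖α⁻¹‖ ≤ ‖(theta Fq)⁻¹‖ := by
  have hq : (1 : ℝ) < Fintype.card Fq := by exact_mod_cast Fintype.one_lt_card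
  rw [neg_vInf_of_ne_zero hα, ← EReal.coe_one, EReal.coe_le_coe_iff,
    Real.le_logb_iff_rpow_le hq (norm_pos_iff.mpr hα), Real.rpow_one] at h
  rw [norm_inv, norm_inv, norm_theta]
  exact inv_anti₀ (by positivity) h

lemma norm_div_le_of_neg_vInf_add_one_le {t α : CInf Fq} (hα : α ≠ 0)
    (h : -vInf t + 1 ≤ -vInf α) : ‖t / α‖ ≤ ‖(theta Fq)⁻¹‖ := by
  have hq : (1 : ℝ) < Fintype.card Fq := by exact_mod_cast Fintype.one_lt_card
  -- For `t = 0` the hypothesis is void, as `-v_∞(0) = -∞`, but the quotient is `0`.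
  rcases eq_or_ne t 0 with rfl | ht
  · simp
  have hα' := norm_pos_iff.mpr hα
  have ht' := norm_pos_iff.mpr ht
  rw [neg_vInf_of_ne_zero hα, neg_vInf_of_ne_zero ht, ← EReal.coe_one, ← EReal.coe_add,
    EReal.coe_le_coe_iff, Real.le_logb_iff_rpow_le hq hα', Real.rpow_add (by positivity),
    Real.rpow_logb (by positivity) hq.ne' ht', Real.rpow_one] at h
  rw [norm_div, norm_inv, norm_theta, div_le_iff₀ hα', inv_mul_eq_div, le_div_iff₀ (by positivity)]
  exact h

/-- An admissible `α` of least size: `θ` if `|t| ≤ 1`, and `θt` otherwise. -/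
lemma exists_norm_div_le (t : CInf Fq) : ∃ α : CInf Fq, α ≠ 0 ∧
    ‖t / α‖ ≤ ‖(theta Fq)⁻¹‖ ∧ ‖α⁻¹‖ ≤ ‖(theta Fq)⁻¹‖ := by
  have hθ := theta_ne_zero (Fq := Fq)
  rcases le_total ‖t‖ 1 with ht | ht
  · refine ⟨theta Fq, hθ, ?_, le_rfl⟩
    rw [div_eq_mul_inv, norm_mul]
    exact mul_le_of_le_one_left (norm_nonneg _) ht
  · have ht0 : t ≠ 0 := norm_pos_iff.mp (zero_lt_one.trans_le ht)
    refine ⟨theta Fq * t, mul_ne_zero hθ ht0, ?_, ?_⟩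
    · rw [div_mul_cancel_right₀ ht0]
    · rw [mul_inv, norm_mul, norm_inv t]
      exact mul_le_of_le_one_right (norm_nonneg _) (inv_le_one_of_one_le₀ ht)

variable {p : ℕ} [Fact p.Prime] [CharP Fq p]

-- Undoing the scaling by `α` costs only the geometric factor `(‖α‖ ^ β) ^ j`. The factor `q - 1 ≥
-- 1` in the exponent is dropped.
variable (p) in
lemma exists_norm_pellarinCoeff_le (t : CInf Fq) (β : ℕ) : ∃ A : ℝ, 0 ≤ A ∧
    ∀ (j : ℕ) (y : ℤ_[p]), ‖pellarinCoeff t β j y‖ ≤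
      A ^ j * ‖(theta Fq)⁻¹‖ ^ ∑ i ∈ Finset.range (j + 1), i := by
  obtain ⟨α, hα, ht, hα'⟩ := exists_norm_div_le t
  refine ⟨‖α‖ ^ β, by positivity, fun j y => ?_⟩
  have h := norm_pellarinCoeff_div_le ht hα' β j y
  rw [norm_div, div_le_iff₀ (norm_pos_iff.mpr (pow_ne_zero _ (pow_ne_zero _ hα))), mul_comm,
    norm_pow, norm_pow, pow_right_comm] at h
  refine h.trans (mul_le_mul_of_nonneg_left ?_ (by positivity))
  exact pow_le_pow_of_le_one (norm_nonneg _) norm_theta_inv_le_one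
    (Nat.le_mul_of_pos_left _ (Nat.sub_pos_of_lt Fintype.one_lt_card))

lemma continuous_pellarinCoeff (t : CInf Fq) (β j : ℕ) :
    Continuous fun y : ℤ_[p] => pellarinCoeff t β j y :=
  continuous_finsetSum _ fun _ ha => continuous_const.mul <|
    (continuous_unitPow (norm_oneUnit_sub_one_lt_one (mem_monicsOfDegree.mp ha).1)).comp
      continuous_neg

variable (p) in
/-- On every half-plane the expansion by degrees is dominated by a convergent series. -/
lemma exists_summable_bound (t : CInf Fq) (β : ℕ) {R : ℝ} (hR : 0 ≤ R) : ∃ u : ℕ → ℝ, Summable u ∧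
    ∀ (j : ℕ) (y : ℤ_[p]), ‖pellarinCoeff t β j y‖ * R ^ j ≤ u j := by
  obtain ⟨A, hA, h⟩ := exists_norm_pellarinCoeff_le p t β
  refine ⟨_, summable_pow_mul_pow_triangular (norm_pos_iff.mpr (inv_ne_zero theta_ne_zero))
    (norm_theta_inv_lt_one (Fq := Fq)) (A * R) (by positivity), fun j y => ?_⟩
  rw [mul_pow, mul_right_comm]
  exact mul_le_mul_of_nonneg_right (h j y) (by positivity)

/-- The expansion by degrees of the Pellarin `L`-series. -/
def pellarinL (t : CInf Fq) (β : ℕ) (s : SInf Fq p) : CInf Fq :=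
  ∑' j : ℕ, pellarinCoeff t β j s.2 * ((s.1⁻¹ : (CInf Fq)ˣ) : CInf Fq) ^ j

lemma norm_mul_pow_le {E : Type*} [NormedField E] (c : E) {x : E} {R : ℝ} (hx : ‖x‖ ≤ R) (j : ℕ) :
    ‖c * x ^ j‖ ≤ ‖c‖ * R ^ j := by
  rw [norm_mul, norm_pow]
  gcongr

lemma hasSum_pellarinL (t : CInf Fq) (β : ℕ) (s : SInf Fq p) :
    HasSum (fun j : ℕ => pellarinCoeff t β j s.2 * ((s.1⁻¹ : (CInf Fq)ˣ) : CInf Fq) ^ j)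
      (pellarinL t β s) := by
  obtain ⟨u, hu, h⟩ :=
    exists_summable_bound p t β (norm_nonneg ((s.1⁻¹ : (CInf Fq)ˣ) : CInf Fq))
  exact (Summable.of_norm_bounded hu fun j =>
    (norm_mul_pow_le _ le_rfl j).trans (h j s.2)).hasSum

lemma continuous_pellarinL (t : CInf Fq) (β : ℕ) :
    Continuous (pellarinL (p := p) t β) := by
  have hinv : Continuous fun s : SInf Fq p => ((s.1⁻¹ : (CInf Fq)ˣ) : CInf Fq) :=
    Units.continuous_val.comp (continuous_inv.comp continuous_fst)
  rw [continuous_iff_continuousAt]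
  intro s₀
  -- The extra `1` gives an open neighbourhood of `s₀` on which one summable bound holds.
  set R := ‖((s₀.1⁻¹ : (CInf Fq)ˣ) : CInf Fq)‖ + 1 with hR
  obtain ⟨u, hu, h⟩ := exists_summable_bound p t β (R := R) (by positivity)
  have hopen : IsOpen {s : SInf Fq p | ‖((s.1⁻¹ : (CInf Fq)ˣ) : CInf Fq)‖ < R} :=
    isOpen_lt hinv.norm continuous_const
  refine (continuousOn_tsum (fun j => Continuous.continuousOn ?_) hu fun j s hs =>
    (norm_mul_pow_le _ (le_of_lt hs) j).trans (h j s.2)).continuousAt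
      (hopen.mem_nhds (show ‖((s₀.1⁻¹ : (CInf Fq)ˣ) : CInf Fq)‖ < R by rw [hR]; linarith))
  exact ((continuous_pellarinCoeff t β j).comp continuous_snd).mul (hinv.pow j)

lemma isEntire_pellarinL (t : CInf Fq) (β : ℕ) : IsEntire (pellarinL (p := p) t β) := by
  refine ⟨⟨fun j y => pellarinCoeff t β j y, fun y R => ?_, hasSum_pellarinL t β⟩, ?_⟩
  · obtain ⟨u, hu, h⟩ := exists_summable_bound p t β (abs_nonneg R)
    refine squeeze_zero_norm (fun j => ?_) hu.tendsto_atTop_zero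
    rw [norm_mul, norm_norm, norm_pow, Real.norm_eq_abs]
    exact h j y
  · intro R ε hε
    obtain ⟨u, hu, h⟩ := exists_summable_bound p t β (abs_nonneg R)
    have hbound : ∀ (j : ℕ) (y y' : ℤ_[p]),
        ‖pellarinCoeff t β j y - pellarinCoeff t β j y'‖ * |R| ^ j ≤ u j + u j := fun j y y' =>
      (mul_le_mul_of_nonneg_right (norm_sub_le _ _) (by positivity)).trans
        ((add_mul _ _ _).trans_le (add_le_add (h j y) (h j y')))
    -- `G (y, y')` majorizes the difference for all `|x⁻¹| ≤ R` at once. It vanishes on the diagonal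
    -- and is uniformly continuous by compactness, so comparison with `(y', y')` gives a `δ`
    -- independent of `y` and `x`.
    let G : ℤ_[p] × ℤ_[p] → ℝ := fun z =>
      ∑' j, ‖pellarinCoeff t β j z.1 - pellarinCoeff t β j z.2‖ * |R| ^ j
    have hG : Continuous G := by
      refine continuous_tsum (fun j => ?_) (hu.add hu) fun j z => ?_
      · exact ((((continuous_pellarinCoeff t β j).comp continuous_fst).sub
          ((continuous_pellarinCoeff t β j).comp continuous_snd)).norm).mul continuous_const
      · rw [Real.norm_of_nonneg (by positivity)]
        exact hbound j z.1 z.2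
    obtain ⟨δ, hδ, hGδ⟩ :=
      Metric.uniformContinuous_iff.mp (CompactSpace.uniformContinuous_of_continuous hG) ε hε
    refine ⟨δ, hδ, fun y y' hy x hx => ?_⟩
    have hdist : dist (y, y') (y', y') < δ := by
      rw [Prod.dist_eq, dist_self, max_eq_left dist_nonneg, dist_eq_norm]
      exact hy
    have hlt : G (y, y') < ε := by
      have h0 : G (y', y') = 0 := by simp [G]
      have := hGδ hdist
      rw [h0, Real.dist_0_eq_abs] at this
      exact (le_abs_self _).trans_lt this
    refine lt_of_le_of_lt ?_ hlt
    have hs := (hasSum_pellarinL t β (x, y)).sub (hasSum_pellarinL t β (x, y'))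
    rw [← hs.tsum_eq]
    refine tsum_of_norm_bounded (Summable.of_nonneg_of_le (fun j => by positivity)
      (fun j => hbound j y y') (hu.add hu)).hasSum fun j => ?_
    rw [← sub_mul]
    exact norm_mul_pow_le _ (hx.trans (le_abs_self R)) j

/-! ### Convergence on the half-plane and regrouping by degree -/

lemma pellarinTerm_eq (t : CInf Fq) (β : ℕ) (s : SInf Fq p) (a : Polynomial Fq) :
    pellarinTerm t β s a = chi t a ^ β * unitPow (oneUnit a) (-s.2) *
      ((s.1⁻¹ : (CInf Fq)ˣ) : CInf Fq) ^ a.natDegree := by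
  rw [pellarinTerm, expS, negS]
  ring

lemma norm_pellarinTerm_le (t : CInf Fq) (β : ℕ) (s : SInf Fq p) {a : Polynomial Fq}
    (ha : a.Monic) :
    ‖pellarinTerm t β s a‖ ≤ (max 1 ‖t‖ ^ β / ‖(s.1 : CInf Fq)‖) ^ a.natDegree := by
  rw [pellarinTerm_eq, norm_mul, norm_mul, norm_pow, norm_pow, Units.val_inv_eq_inv_val, norm_inv,
    div_eq_mul_inv, mul_pow, pow_right_comm]
  refine mul_le_mul_of_nonneg_right ?_ (by positivity)
  exact (mul_le_of_le_one_right (by positivity)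
    (norm_unitPow_le_one (norm_oneUnit_sub_one_lt_one ha) _)).trans
      (pow_le_pow_left₀ (norm_nonneg _) (norm_chi_le t a) β)

/-- In a complete ultrametric group, terms tending to zero suffice. Each degree has finitely many
monics, and their number `q^j` plays no role. -/
lemma summable_pellarinTerm (t : CInf Fq) (β : ℕ) {s : SInf Fq p}
    (hs : max 1 ‖t‖ ^ β < ‖(s.1 : CInf Fq)‖) :
    Summable fun a : {a : Polynomial Fq // a.Monic} => pellarinTerm t β s a := by
  refine NonarchimedeanAddGroup.summable_of_tendsto_cofinite_zero ?_
  have hdeg : Tendsto (fun a : {a : Polynomial Fq // a.Monic} => (a : Polynomial Fq).natDegree)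
      cofinite atTop := by
    rw [← Nat.cofinite_eq_atTop]
    refine Tendsto.cofinite_of_finite_preimage_singleton fun j => ?_
    refine Set.Finite.of_finite_image ((finite_monicsOfDegree Fq j).subset ?_)
      Subtype.val_injective.injOn
    rintro _ ⟨a, ha, rfl⟩
    exact ⟨a.2, ha⟩
  have hs0 : 0 < ‖(s.1 : CInf Fq)‖ := norm_pos_iff.mpr s.1.ne_zero
  exact squeeze_zero_norm (fun a => norm_pellarinTerm_le t β s a.2)
    ((tendsto_pow_atTop_nhds_zero_of_lt_one (by positivity) ((div_lt_one hs0).mpr hs)).comp hdeg)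

/-- The monic polynomials of degree `j` as a fibre of the degree. -/
def monicsOfDegreeEquiv (j : ℕ) : monicsOfDegree Fq j ≃
    {a : {a : Polynomial Fq // a.Monic} // (a : Polynomial Fq).natDegree = j} where
  toFun a := ⟨⟨a, (mem_monicsOfDegree.mp a.2).1⟩, (mem_monicsOfDegree.mp a.2).2⟩
  invFun a := ⟨a.1, mem_monicsOfDegree.mpr ⟨a.1.2, a.2⟩⟩

lemma hasSum_pellarinTerm (t : CInf Fq) (β : ℕ) {s : SInf Fq p}
    (hs : max 1 ‖t‖ ^ β < ‖(s.1 : CInf Fq)‖) :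
    HasSum (fun a : {a : Polynomial Fq // a.Monic} => pellarinTerm t β s a)
      (pellarinL t β s) := by
  have hsum := (summable_pellarinTerm t β hs).hasSum
  let e := Equiv.sigmaFiberEquiv
    fun a : {a : Polynomial Fq // a.Monic} => (a : Polynomial Fq).natDegree
  have hfib : ∀ j : ℕ, HasSum (fun a : {a : {a : Polynomial Fq // a.Monic} //
      (a : Polynomial Fq).natDegree = j} => pellarinTerm t β s (a.1 : Polynomial Fq))
      (pellarinCoeff t β j s.2 * ((s.1⁻¹ : (CInf Fq)ˣ) : CInf Fq) ^ j) := fun j => by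
    rw [← (monicsOfDegreeEquiv j).hasSum_iff, pellarinCoeff, Finset.sum_mul]
    have heq : ∑ a ∈ monicsOfDegree Fq j, chi t a ^ β * unitPow (oneUnit a) (-s.2) *
        ((s.1⁻¹ : (CInf Fq)ˣ) : CInf Fq) ^ j = ∑ a ∈ monicsOfDegree Fq j, pellarinTerm t β s a :=
      Finset.sum_congr rfl fun a ha => by rw [pellarinTerm_eq, (mem_monicsOfDegree.mp ha).2]
    rw [heq]
    exact (monicsOfDegree Fq j).hasSum _
  -- Summing first over each degree gives the defining series of `pellarinL`.
  have h := (e.hasSum_iff.mpr hsum).sigma hfib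
  rwa [h.unique (hasSum_pellarinL t β s)] at hsum

end Main

end Pellarin

end

theorem theorem4p2 {Fq : Type*} [Field Fq] [Fintype Fq] {p : ℕ} [Fact p.Prime] [CharP Fq p]
    (t : Pellarin.CInf Fq) (β : ℕ) :
    ∃ L : Pellarin.SInf Fq p → Pellarin.CInf Fq,
      -- `L` is the sum of the Pellarin `L`-series on the half-plane `|x| > max(1, |t|)^β`
      (∀ s : Pellarin.SInf Fq p, max 1 ‖t‖ ^ β < ‖(s.1 : Pellarin.CInf Fq)‖ →
        HasSum (fun a : {a : Polynomial Fq // a.Monic} => Pellarin.pellarinTerm t β s a) (L s)) ∧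
      -- `L` is entire on `S_∞`, and jointly continuous in `(x, y)`
      Pellarin.IsEntire L ∧ Continuous L ∧
      -- on all of `S_∞` it is given by the expansion by degrees
      (∀ s : Pellarin.SInf Fq p, HasSum (fun j : ℕ => Pellarin.pellarinCoeff t β j s.2 *
        ((s.1⁻¹ : (Pellarin.CInf Fq)ˣ) : Pellarin.CInf Fq) ^ j) (L s)) ∧
      -- the coefficient of `x^{-j}` in `L(α^β x, y)` has valuation at least `(q-1)j(j+1)/2`
      ∀ α : Pellarin.CInf Fq, α ≠ 0 →
        max (-Pellarin.vInf t + 1) 1 ≤ -Pellarin.vInf α →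
        ∀ (j : ℕ) (y : ℤ_[p]),
          (((Fintype.card Fq - 1 : ℝ) * j * (j + 1) / 2 : ℝ) : EReal) ≤
            Pellarin.vInf (Pellarin.pellarinCoeff t β j y / (α ^ j) ^ β) := by
  refine ⟨Pellarin.pellarinL t β, fun s hs => Pellarin.hasSum_pellarinTerm t β hs,
    Pellarin.isEntire_pellarinL t β, Pellarin.continuous_pellarinL t β,
    Pellarin.hasSum_pellarinL t β, fun α hα h j y => ?_⟩
  rw [max_le_iff] at h
  convert Pellarin.le_vInf_of_norm_le (Pellarin.norm_pellarinCoeff_div_le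
    (Pellarin.norm_div_le_of_neg_vInf_add_one_le hα h.1)
    (Pellarin.norm_inv_le_of_one_le_neg_vInf hα h.2) β j y) using 2
  -- Doubling the triangular number avoids truncated division before the cast to `ℝ`.
  have hsum : (((∑ i ∈ Finset.range (j + 1), i : ℕ) : ℝ)) * 2 = j * (j + 1) := by
    have := Finset.sum_range_id_mul_two (j + 1)
    rw [Nat.add_sub_cancel, mul_comm (j + 1)] at this
    exact_mod_cast this
  rw [Nat.cast_mul, Nat.cast_sub Fintype.card_pos, Nat.cast_one, mul_assoc, ← hsum]
  ring
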